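/- Consider a deterministic two-period overlapping generations endowment economy with dates $t=0,1,2,\dots$. A unit mass of agents is born at each date; an agent born at $t$ has utility $u(y_t)+\beta u(z_{t+1})$ over consumption $y_t\ge 0$ when young and $z_{t+1}\ge 0$ when old, where $\beta>0$ and $u$ has constant relative risk aversion $\gamma>0$: $u(c)=\frac{c^{1-\gamma}}{1-\gamma}$ if $\gamma\ne 1$ and $u(c)=\log c$ if $\gamma=1$ (with $u(0)=-\infty$ if $\gamma\ge 1$). At date $t$ the young are endowed with $aG^t$ and the old with $bG^t$ units of the good, where $G>1$, $a>0$, $b\ge 0$. There is a unit supply of an infinitely lived asset paying a constant dividend $D_t=D>0$, and it is assumed that $a>\beta^{-1/\gamma}Gb$. A competitive equilibrium is a sequence $\{(P_t,x_t,y_t,z_t)\}_{t=0}^\infty$ with asset prices $P_t\ge 0$ such that: (i) $z_0=b+P_0+D$, and for every $t$ the choice $(x_t,y_t,z_{t+1})$ maximizes $u(y)+\beta u(z)$ over all $x\in\mathbb{R}$, $y,z\ge 0$ with $y+P_tx=aG^t$ and $z=bG^{t+1}+(P_{t+1}+D)x$; (ii) $y_t+z_t=aG^t+bG^t+D$ for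 all $t$; (iii) $x_t=1$ for all $t$. Let $q_t>0$ be the Arrow–Debreu prices, given by $q_0=1$ and $q_tP_t=q_{t+1}(P_{t+1}+D)$. The equilibrium is bubbly if $P_0>V_0:=\sum_{t=1}^\infty q_tD$, and it is asymptotically bubbly if moreover $\liminf_{t\to\infty}P_t/(aG^t)>0$. Set $$w=\frac{b}{a},\qquad \kappa=(\beta G^{1-\gamma})^{1/\gamma},\qquad \xi_1^*=\frac{\kappa-w}{1+\kappa}.$$ Suppose that $\frac1\gamma\neq\frac{\kappa-w}{\kappa(1+w)}$. Then there exists an asymptotically bubbly equilibrium such that $P_t/(aG^t)\to\xi_1^*$ as $t\to\infty$. If in addition $$\frac1\gamma>\frac12\,\frac{\kappa-w}{\kappa}\,\frac{1-\kappa}{1+w},$$ then there is exactly one asymptotically bubbly equilibrium with $P_t/(aG^t)\to\xi_1^*$. -/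

import Mathlib

open Filter Topology

noncomputable section

/-- Data of a two-period overlapping generations endowment economy with one long-lived asset in
unit supply.  `U t y z` is the utility of generation `t` from consuming `y` when young (date `t`)
and `z` when old (date `t + 1`); it is only ever evaluated at nonnegative arguments and may be `⊥`
(that is, `-∞`).  `a t`, `b t` are the endowments of the young and of the old at date `t`, and `D t`
is the dividend of the asset at date `t`. -/
structure OLGEconomy where
  U : ℕ → ℝ → ℝ → EReal
  a : ℕ → ℝ
  b : ℕ → ℝ
  D : ℕ → ℝ

/-- Sequences of asset prices, asset demands of the young, and consumption of the young and of the
old. -/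
structure PriceAllocation where
  P : ℕ → ℝ
  x : ℕ → ℝ
  y : ℕ → ℝ
  z : ℕ → ℝ

namespace OLGEconomy

/-- `(x, y, z)` is affordable for generation `t` at prices `P`: asset holdings `x` are an arbitrary
real number, consumption is nonnegative, and the two budget constraints hold. -/
structure InBudget (E : OLGEconomy) (P : ℕ → ℝ) (t : ℕ) (x y z : ℝ) : Prop where
  young_nonneg : 0 ≤ y
  old_nonneg : 0 ≤ z
  young : y + P t * x = E.a t
  old : z = E.b (t + 1) + (P (t + 1) + E.D (t + 1)) * x

/-- Competitive equilibrium with sequential trading. -/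
structure IsEquilibrium (E : OLGEconomy) (A : PriceAllocation) : Prop where
  price_nonneg : ∀ t, 0 ≤ A.P t
  initial_old : A.z 0 = E.b 0 + A.P 0 + E.D 0
  feasible : ∀ t, E.InBudget A.P t (A.x t) (A.y t) (A.z (t + 1))
  optimal : ∀ t x y z, E.InBudget A.P t x y z → E.U t y z ≤ E.U t (A.y t) (A.z (t + 1))
  goods_clearing : ∀ t, A.y t + A.z t = E.a t + E.b t + E.D t
  asset_clearing : ∀ t, A.x t = 1

/-- `q` is a sequence of Arrow-Debreu (date-0) prices for the asset prices `P`: positive, normalized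
by `q 0 = 1`, and satisfying the no-arbitrage condition. -/
structure IsArrowDebreu (E : OLGEconomy) (P q : ℕ → ℝ) : Prop where
  zero : q 0 = 1
  pos : ∀ t, 0 < q t
  no_arbitrage : ∀ t, q t * P t = q (t + 1) * (P (t + 1) + E.D (t + 1))

/-- The date-0 fundamental value `∑_{t ≥ 1} q_t D_t` of the asset (possibly infinite). -/
def fundamentalValue (E : OLGEconomy) (q : ℕ → ℝ) : ENNReal :=
  ∑' t : ℕ, ENNReal.ofReal (q (t + 1) * E.D (t + 1))

/-- The asset price exceeds the fundamental value at date 0.  If `P (t + 1) + D (t + 1) > 0` for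
all `t`, the Arrow-Debreu prices are determined by `P`. -/
def IsBubbly (E : OLGEconomy) (P : ℕ → ℝ) : Prop :=
  ∃ q : ℕ → ℝ, E.IsArrowDebreu P q ∧ E.fundamentalValue q < ENNReal.ofReal (P 0)

/-- The asset is asymptotically relevant: `liminf P_t / a_t > 0` (taken in the extended reals). -/
def IsAsymptoticallyRelevant (E : OLGEconomy) (P : ℕ → ℝ) : Prop :=
  0 < liminf (fun t => ((P t / E.a t : ℝ) : EReal)) atTop

/-- Asymptotically bubbly equilibrium: an equilibrium that is bubbly and in which the asset is
asymptotically relevant. -/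
structure IsAsymptoticallyBubbly (E : OLGEconomy) (A : PriceAllocation) : Prop where
  equilibrium : E.IsEquilibrium A
  bubbly : E.IsBubbly A.P
  relevant : E.IsAsymptoticallyRelevant A.P

end OLGEconomy

/-- CRRA period utility on `[0, ∞)`, with the continuous extension at `0`, which is `-∞` when
`1 ≤ γ`.  (For `γ < 1` the power is `0` at `0`.) -/
def crra (γ c : ℝ) : EReal :=
  if c = 0 ∧ 1 ≤ γ then ⊥
  else if γ = 1 then ((Real.log c : ℝ) : EReal)
  else ((c ^ (1 - γ) / (1 - γ) : ℝ) : EReal)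

/-- The OLG economy with CRRA utility `u(y) + β u(z)`, endowments `(a G^t, b G^t)`, and constant
dividends `D`. -/
def crraEconomy (β γ G a b D : ℝ) : OLGEconomy where
  U := fun _ y z => crra γ y + (β : EReal) * crra γ z
  a := fun t => a * G ^ t
  b := fun t => b * G ^ t
  D := fun _ => D

end

/-! Write x_t = P_t/(aG^t) and d_t = D/(aG^t). Once equilibrium is shown to be interior, it amounts
to 0 < x_t < 1 and the Euler equation F(x_t) = H(x_{t+1} + d_{t+1}), where F(x) = log x - γ log(1-x)
and H(e) = log(βG^{1-γ}) + log e - γ log(w+e). At d = 0 this has the fixed point ξ, and d decays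
like G^{-t}.

Existence: let A = F'(ξ) > 0 and B = H'(ξ). If |B| < AG, solving backward maps shrinking balls
around ξ into one another, and compactness gives an orbit; otherwise the forward map contracts at
rate at most 1/G and can simply be iterated (`exists_tail`). The path obtained near infinity extends
back to date 0 because F is a bijection from (0,1) to ℝ. Since P_t grows like G^t, the sum of D/P_t
is finite, which forces a bubble (`isBubbly_of_summable`).

Uniqueness: the extra condition says exactly that A + B > 0, while B < A always holds. Hence |B| <
A, the backward map contracts, and two paths tending to ξ agree eventually
(`eventually_eq_of_tendsto`), hence everywhere, F being injective. -/

noncomputable section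

/-! ### Perturbed recursions near a steady state -/

/-- A sequence of continuous maps between nonempty compact sets, `h t` mapping `I (t + 1)` to
`I t`, admits a complete orbit. -/
lemma exists_orbit_of_mapsTo_compact (I : ℕ → Set ℝ) (h : ℕ → ℝ → ℝ)
    (hI : ∀ t, IsCompact (I t)) (hne : ∀ t, (I t).Nonempty)
    (hc : ∀ t, ContinuousOn (h t) (I (t + 1)))
    (hm : ∀ t, Set.MapsTo (h t) (I (t + 1)) (I t)) :
    ∃ x : ℕ → ℝ, ∀ t, x t ∈ I t ∧ x t = h t (x (t + 1)) := by
  -- Sequences obeying the recursion at the first `n` dates: nested closed subsets of a product that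
  -- is compact by Tychonoff, so a common point exists.
  let S : ℕ → Set (ℕ → ℝ) := fun n =>
    {x | x ∈ Set.univ.pi I ∧ ∀ t < n, x t = h t (x (t + 1))}
  have hpi : IsCompact (Set.univ.pi I) := isCompact_univ_pi hI
  have hS0 : IsCompact (S 0) := by
    have : S 0 = Set.univ.pi I := by ext x; simp [S]
    rwa [this]
  have hcl : ∀ n, IsClosed (S n) := by
    intro n
    induction n with
    | zero => exact hS0.isClosed
    | succ n ih =>
      have hcont : ContinuousOn (fun x : ℕ → ℝ => x n - h n (x (n + 1))) (Set.univ.pi I) :=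
        (continuous_apply n).continuousOn.sub
          ((hc n).comp (continuous_apply (n + 1)).continuousOn fun x hx => hx (n + 1) trivial)
      have h1 := hcont.preimage_isClosed_of_isClosed hpi.isClosed (isClosed_singleton (x := 0))
      convert ih.inter h1 using 1
      ext x
      simp only [S, Set.mem_ofPred_eq, Set.mem_inter_iff, Set.mem_preimage, Set.mem_singleton_iff,
        sub_eq_zero]
      constructor
      · rintro ⟨hx, h2⟩
        exact ⟨⟨hx, fun t ht => h2 t (by omega)⟩, hx, h2 n (by omega)⟩
      · rintro ⟨⟨hx, h2⟩, -, h3⟩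
        refine ⟨hx, fun t ht => ?_⟩
        rcases Nat.lt_succ_iff_lt_or_eq.mp ht with h4 | rfl
        exacts [h2 t h4, h3]
  have hnon : ∀ n, (S n).Nonempty := by
    -- The starting date `m` is left free because the induction prepends a value at `m` to a
    -- solution starting at `m + 1`.
    have key : ∀ n, ∀ m, ∃ x : ℕ → ℝ, (∀ t, x t ∈ I t) ∧
        ∀ t, m ≤ t → t < m + n → x t = h t (x (t + 1)) := by
      intro n
      induction n with
      | zero =>
        intro m
        choose x hx using hne
        exact ⟨x, hx, fun t h1 h2 => by omega⟩
      | succ n ih =>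
        intro m
        obtain ⟨x, hx, h1⟩ := ih (m + 1)
        refine ⟨Function.update x m (h m (x (m + 1))), fun t => ?_, fun t h2 h3 => ?_⟩
        · rcases eq_or_ne t m with rfl | ht
          · simpa using hm t (hx (t + 1))
          · simpa [ht] using hx t
        · rcases eq_or_ne t m with rfl | ht
          · simp
          · rw [Function.update_of_ne ht, Function.update_of_ne (by omega)]
            exact h1 t (by omega) (by omega)
    intro n
    obtain ⟨x, hx, h1⟩ := key n 0
    exact ⟨x, fun t _ => hx t, fun t ht => h1 t (Nat.zero_le _) (by omega)⟩
  obtain ⟨x, hx⟩ := IsCompact.nonempty_iInter_of_sequence_nonempty_isCompact_isClosed S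
    (fun n x hx => ⟨hx.1, fun t ht => hx.2 t (by omega)⟩) hnon hS0 hcl
  rw [Set.mem_iInter] at hx
  exact ⟨x, fun t => ⟨(hx 0).1 t trivial, (hx (t + 1)).2 t (by omega)⟩⟩

/-- A function with strict derivative `φ'` is `K`-Lipschitz on a closed interval around the point,
for every `K > |φ'|`. -/
lemma HasStrictDerivAt.exists_lipschitz_Icc {φ : ℝ → ℝ} {φ' x₀ K : ℝ}
    (hφ : HasStrictDerivAt φ φ' x₀) (hK : |φ'| < K) :
    ∃ δ > 0, ∀ x y, |x - x₀| ≤ δ → |y - x₀| ≤ δ → |φ x - φ y| ≤ K * |x - y| := by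
  have hK0 : 0 ≤ K := (abs_nonneg _).trans hK.le
  lift K to NNReal using hK0
  obtain ⟨s, hs, hL⟩ := hφ.hasStrictFDerivAt.exists_lipschitzOnWith_of_nnnorm_lt
    (K := K) (by
      rw [← NNReal.coe_lt_coe]
      simpa using hK)
  obtain ⟨δ, hδ, hb⟩ := Metric.nhds_basis_closedBall.mem_iff.mp hs
  refine ⟨δ, hδ, fun x y hx hy => ?_⟩
  have := hL.dist_le_mul x (hb (by simpa [Real.dist_eq] using hx)) y
    (hb (by simpa [Real.dist_eq] using hy))
  simpa [Real.dist_eq] using this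

/-- A perturbed backward recursion with perturbation decaying at rate `ρ` has a solution converging
to the fixed point if the derivative there is less than `1 / ρ` in absolute value. -/
lemma exists_tail_backward {φ : ℝ → ℝ} {φ' x₀ ρ D₀ : ℝ} {d : ℕ → ℝ}
    (hφ : HasStrictDerivAt φ φ' x₀) (hfix : φ x₀ = x₀) (hρ0 : 0 < ρ) (hρ1 : ρ < 1)
    (hD : 0 < D₀) (hd : ∀ t, |d t| ≤ D₀ * ρ ^ t) (hlt : |φ'| * ρ < 1) :
    ∃ (T : ℕ) (x : ℕ → ℝ), (∀ t ≥ T, x t = φ (x (t + 1) + d (t + 1))) ∧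
      Tendsto x atTop (𝓝 x₀) := by
  obtain ⟨K, hK1, hK2⟩ := exists_between ((lt_div_iff₀ hρ0).mpr hlt)
  have hK0 : 0 < K := (abs_nonneg _).trans_lt hK1
  have hKρ : K * ρ < 1 := (lt_div_iff₀ hρ0).mp hK2
  obtain ⟨δ, hδ, hL⟩ := hφ.exists_lipschitz_Icc hK1
  -- `C` is the fixed point of C ↦ Kρ(C + D₀), so the ball of radius Cρ^(t+1) is sent into the one
  -- of radius Cρ^t.
  set C : ℝ := K * ρ * D₀ / (1 - K * ρ) with hC
  have h1K : 0 < 1 - K * ρ := by linarith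
  have hC0 : 0 < C := by positivity
  have hCeq : K * ρ * (C + D₀) = C := by rw [hC]; field_simp; ring
  have hlim : Tendsto (fun t : ℕ => (C + D₀) * ρ ^ t) atTop (𝓝 0) := by
    simpa using (tendsto_pow_atTop_nhds_zero_of_lt_one hρ0.le hρ1).const_mul (C + D₀)
  obtain ⟨T, hT⟩ := eventually_atTop.mp (hlim.eventually (gt_mem_nhds hδ))
  let I : ℕ → Set ℝ := fun t => Metric.closedBall x₀ (C * ρ ^ (t + T))
  have hnear : ∀ t, ∀ x ∈ I (t + 1), |x + d (t + 1 + T) - x₀| ≤ (C + D₀) * ρ ^ (t + 1 + T) := by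
    intro t x hx
    have hx' : |x - x₀| ≤ C * ρ ^ (t + 1 + T) := by simpa [I, Real.dist_eq] using hx
    calc |x + d (t + 1 + T) - x₀| = |(x - x₀) + d (t + 1 + T)| := by ring_nf
      _ ≤ |x - x₀| + |d (t + 1 + T)| := abs_add_le _ _
      _ ≤ C * ρ ^ (t + 1 + T) + D₀ * ρ ^ (t + 1 + T) := add_le_add hx' (hd _)
      _ = _ := by ring
  have hnearδ : ∀ t, ∀ x ∈ I (t + 1), |x + d (t + 1 + T) - x₀| ≤ δ := fun t x hx =>
    (hnear t x hx).trans (hT _ (by omega)).le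
  obtain ⟨x, hx⟩ := exists_orbit_of_mapsTo_compact I (fun t x => φ (x + d (t + 1 + T)))
    (fun t => isCompact_closedBall _ _)
    (fun t => ⟨x₀, Metric.mem_closedBall_self (by positivity)⟩)
    (fun t => by
      have : LipschitzOnWith K.toNNReal (fun x => φ (x + d (t + 1 + T))) (I (t + 1)) :=
        LipschitzOnWith.of_dist_le_mul fun x hx y hy => by
          have := hL _ _ (hnearδ t x hx) (hnearδ t y hy)
          simpa [Real.dist_eq, hK0.le] using this
      exact this.continuousOn)
    (fun t x hx => by
      have h1 := hL _ x₀ (hnearδ t x hx) (by simpa using hδ.le)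
      rw [hfix] at h1
      have h2 : |φ (x + d (t + 1 + T)) - x₀| ≤ C * ρ ^ (t + T) := by
        calc _ ≤ K * ((C + D₀) * ρ ^ (t + 1 + T)) :=
              h1.trans (mul_le_mul_of_nonneg_left (hnear t x hx) hK0.le)
          _ = (K * ρ * (C + D₀)) * ρ ^ (t + T) := by ring
          _ = _ := by rw [hCeq]
      simpa [I, Real.dist_eq] using h2)
  -- Truncated subtraction makes the shifted sequence constant before `T`, where nothing is claimed.
  refine ⟨T, fun t => x (t - T), fun t ht => ?_, ?_⟩
  · have := (hx (t - T)).2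
    rw [show t - T + 1 + T = t + 1 by omega] at this
    simpa only [show t + 1 - T = t - T + 1 by omega] using this
  · refine (tendsto_sub_nhds_zero_iff (u := x)).mp ?_ |>.comp (tendsto_sub_atTop_nat T)
    refine squeeze_zero_norm (a := fun t : ℕ => (C + D₀) * ρ ^ t) (fun t => ?_) hlim
    have h1 : |x t - x₀| ≤ C * ρ ^ (t + T) := by simpa [I, Real.dist_eq] using (hx t).1
    have h2 : ρ ^ (t + T) ≤ ρ ^ t := pow_le_pow_of_le_one hρ0.le hρ1.le (by omega)
    have h3 : 0 < ρ ^ t := by positivity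
    rw [Real.norm_eq_abs]
    nlinarith

/-- A perturbed forward recursion with perturbation decaying at rate `ρ` has a solution converging
to the fixed point if the derivative there is less than `ρ` in absolute value. -/
lemma exists_tail_forward {ψ : ℝ → ℝ} {ψ' x₀ ρ D₀ : ℝ} {d : ℕ → ℝ}
    (hψ : HasStrictDerivAt ψ ψ' x₀) (hfix : ψ x₀ = x₀) (hρ0 : 0 < ρ) (hρ1 : ρ < 1)
    (hD : 0 < D₀) (hd : ∀ t, |d t| ≤ D₀ * ρ ^ t) (hlt : |ψ'| < ρ) :
    ∃ (T : ℕ) (x : ℕ → ℝ), (∀ t ≥ T, ψ (x t) = x (t + 1) + d (t + 1)) ∧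
      Tendsto x atTop (𝓝 x₀) := by
  obtain ⟨K, hK1, hK2⟩ := exists_between hlt
  have hK0 : 0 < K := (abs_nonneg _).trans_lt hK1
  obtain ⟨δ, hδ, hL⟩ := hψ.exists_lipschitz_Icc hK1
  -- Chosen so that KC + D₀ρ = Cρ, which propagates the bound Cρ^t forward.
  set C : ℝ := ρ * D₀ / (ρ - K) with hC
  have h1K : 0 < ρ - K := by linarith
  have hC0 : 0 < C := by positivity
  have hCeq : K * C + D₀ * ρ = C * ρ := by rw [hC]; field_simp; ring
  have hlim : Tendsto (fun t : ℕ => C * ρ ^ t) atTop (𝓝 0) := by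
    simpa using (tendsto_pow_atTop_nhds_zero_of_lt_one hρ0.le hρ1).const_mul C
  obtain ⟨T, hT⟩ := eventually_atTop.mp (hlim.eventually (gt_mem_nhds hδ))
  let x : ℕ → ℝ := fun t => Nat.rec x₀ (fun n y => ψ y - d (n + 1 + T)) t
  have hstep : ∀ t, x (t + 1) = ψ (x t) - d (t + 1 + T) := fun t => rfl
  have hb : ∀ t, |x t - x₀| ≤ C * ρ ^ (t + T) := by
    intro t
    induction t with
    | zero => 
      have : |x 0 - x₀| = 0 := by simp [x]
      rw [this]; positivity
    | succ t ih =>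
      have h1 := hL (x t) x₀ (ih.trans (hT _ (by omega)).le) (by simpa using hδ.le)
      rw [hfix] at h1
      calc |x (t + 1) - x₀| = |(ψ (x t) - x₀) - d (t + 1 + T)| := by rw [hstep]; ring_nf
        _ ≤ |ψ (x t) - x₀| + |d (t + 1 + T)| := abs_sub _ _
        _ ≤ K * (C * ρ ^ (t + T)) + D₀ * ρ ^ (t + 1 + T) :=
          add_le_add (h1.trans (mul_le_mul_of_nonneg_left ih hK0.le)) (hd _)
        _ = (K * C + D₀ * ρ) * ρ ^ (t + T) := by ring
        _ = _ := by rw [hCeq]; ring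
  refine ⟨T, fun t => x (t - T), fun t ht => ?_, ?_⟩
  · have := hstep (t - T)
    rw [show t - T + 1 + T = t + 1 by omega] at this
    simp only [show t + 1 - T = t - T + 1 by omega, this]
    ring
  · refine (tendsto_sub_nhds_zero_iff (u := x)).mp ?_ |>.comp (tendsto_sub_atTop_nat T)
    refine squeeze_zero_norm (a := fun t : ℕ => C * ρ ^ t) (fun t => (hb t).trans ?_) hlim
    have h2 : ρ ^ (t + T) ≤ ρ ^ t := pow_le_pow_of_le_one hρ0.le hρ1.le (by omega)
    nlinarith

/-- The local solution `x = φ y` of `F x = H y` near a common value. -/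
lemma exists_local_solution {F H : ℝ → ℝ} {A B x₀ : ℝ} (hF : HasStrictDerivAt F A x₀)
    (hH : HasStrictDerivAt H B x₀) (h0 : F x₀ = H x₀) (hA : A ≠ 0) :
    ∃ φ : ℝ → ℝ, HasStrictDerivAt φ (A⁻¹ * B) x₀ ∧ φ x₀ = x₀ ∧
      (∀ᶠ y in 𝓝 x₀, F (φ y) = H y) ∧ ∀ᶠ x in 𝓝 x₀, ∀ y, F x = H y → x = φ y := by
  have h1 : HasStrictDerivAt (hF.localInverse F A x₀ hA) A⁻¹ (H x₀) := by
    rw [← h0]; exact hF.to_localInverse hA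
  refine ⟨fun y => hF.localInverse F A x₀ hA (H y), h1.comp x₀ hH, ?_, ?_, ?_⟩
  · show hF.localInverse F A x₀ hA (H x₀) = x₀
    rw [← h0]; exact (hF.eventually_left_inverse hA).self_of_nhds
  · have := hF.eventually_right_inverse hA
    rw [h0] at this
    exact hH.hasDerivAt.continuousAt.eventually this
  · filter_upwards [hF.eventually_left_inverse hA] with x hx y hy
    rw [← hy, hx]

/-- Existence of a solution of `F (x t) = H (x (t + 1) + d (t + 1))` that converges to a steady
state, for a perturbation `d` decaying at rate `1 / G`. -/
lemma exists_tail {F H : ℝ → ℝ} {A B x₀ G D₀ : ℝ} {d : ℕ → ℝ} (hF : HasStrictDerivAt F A x₀)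
    (hH : HasStrictDerivAt H B x₀) (h0 : F x₀ = H x₀) (hA : A ≠ 0) (hG : 1 < G) (hD : 0 < D₀)
    (hd : ∀ t, |d t| ≤ D₀ * (1 / G) ^ t) :
    ∃ (T : ℕ) (x : ℕ → ℝ), (∀ t ≥ T, F (x t) = H (x (t + 1) + d (t + 1))) ∧
      Tendsto x atTop (𝓝 x₀) := by
  have hG0 : 0 < G := by linarith
  have hGi : 1 / G < 1 := by rw [div_lt_one hG0]; exact hG
  have hdlim : Tendsto d atTop (𝓝 0) := by
    refine squeeze_zero_norm hd ?_
    simpa using (tendsto_pow_atTop_nhds_zero_of_lt_one (by positivity) hGi).const_mul D₀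
  have hsum : ∀ x : ℕ → ℝ, Tendsto x atTop (𝓝 x₀) →
      Tendsto (fun t => x (t + 1) + d (t + 1)) atTop (𝓝 x₀) := fun x hx => by
    simpa using ((tendsto_add_atTop_iff_nat 1).mpr hx).add ((tendsto_add_atTop_iff_nat 1).mpr hdlim)
  -- Locally the backward map has slope B/A and the forward map A/B; one of the two decay criteria
  -- applies in each case.
  rcases lt_or_ge (|B|) (|A| * G) with hBA | hBA
  · obtain ⟨φ, hφ, hfix, h1, -⟩ := exists_local_solution hF hH h0 hA
    obtain ⟨T, x, hx, hlim⟩ := exists_tail_backward (ρ := 1 / G) hφ hfix (by positivity) hGi hD hd (by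
      have : 0 < |A| := abs_pos.mpr hA
      rw [abs_mul, abs_inv, inv_mul_eq_div, div_mul_div_comm, mul_one, div_lt_one (by positivity)]
      exact hBA)
    obtain ⟨T', hT'⟩ := eventually_atTop.mp ((hsum x hlim).eventually h1)
    refine ⟨max T T', x, fun t ht => ?_, hlim⟩
    rw [hx t (le_of_max_le_left ht)]
    exact hT' t (le_of_max_le_right ht)
  · have hA0 : 0 < |A| := abs_pos.mpr hA
    have hB0 : 0 < |B| := lt_of_lt_of_le (by positivity) hBA
    obtain ⟨ψ, hψ, hfix, h1, -⟩ := exists_local_solution hH hF h0.symm (abs_pos.mp hB0)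
    -- The forward slope may equal 1/G, so a slower decay rate is used to obtain a strict
    -- inequality.
    have hρ : 1 / G < (1 / G + 1) / 2 := by linarith
    obtain ⟨T, x, hx, hlim⟩ := exists_tail_forward (ρ := (1 / G + 1) / 2) hψ hfix (by positivity)
      (by linarith) hD (fun t => (hd t).trans (by gcongr)) (by
        refine lt_of_le_of_lt ?_ hρ
        rw [abs_mul, abs_inv, inv_mul_eq_div, div_le_div_iff₀ hB0 hG0, one_mul]
        exact hBA)
    obtain ⟨T', hT'⟩ := eventually_atTop.mp (hlim.eventually h1)
    refine ⟨max T T', x, fun t ht => ?_, hlim⟩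
    rw [← hx t (le_of_max_le_left ht)]
    exact (hT' t (le_of_max_le_right ht)).symm

/-- Two solutions of `F (x t) = H (x (t + 1) + d (t + 1))` converging to a steady state with
`|H'| < |F'|` coincide eventually. -/
lemma eventually_eq_of_tendsto {F H : ℝ → ℝ} {A B x₀ : ℝ} {d x x' : ℕ → ℝ}
    (hF : HasStrictDerivAt F A x₀) (hH : HasStrictDerivAt H B x₀) (h0 : F x₀ = H x₀)
    (hBA : |B| < |A|) (hd : Tendsto d atTop (𝓝 0))
    (hx : ∀ t, F (x t) = H (x (t + 1) + d (t + 1)))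
    (hx' : ∀ t, F (x' t) = H (x' (t + 1) + d (t + 1)))
    (hlim : Tendsto x atTop (𝓝 x₀)) (hlim' : Tendsto x' atTop (𝓝 x₀)) :
    ∃ T, ∀ t ≥ T, x t = x' t := by
  have hA0 : 0 < |A| := (abs_nonneg _).trans_lt hBA
  obtain ⟨φ, hφ, hfix, -, h1⟩ := exists_local_solution hF hH h0 (abs_pos.mp hA0)
  have hφ1 : |A⁻¹ * B| < 1 := by
    rwa [abs_mul, abs_inv, inv_mul_eq_div, div_lt_one hA0]
  obtain ⟨K, hK1, hK2⟩ := exists_between hφ1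
  have hK0 : 0 < K := (abs_nonneg _).trans_lt hK1
  obtain ⟨δ, hδ, hL⟩ := hφ.exists_lipschitz_Icc hK1
  have hball : ∀ᶠ y in 𝓝 x₀, |y - x₀| ≤ δ := by
    filter_upwards [Metric.closedBall_mem_nhds x₀ hδ] with y hy
    simpa [Real.dist_eq] using hy
  have hsum : ∀ x : ℕ → ℝ, Tendsto x atTop (𝓝 x₀) →
      Tendsto (fun t => x (t + 1) + d (t + 1)) atTop (𝓝 x₀) := fun x hx => by
    simpa using ((tendsto_add_atTop_iff_nat 1).mpr hx).add ((tendsto_add_atTop_iff_nat 1).mpr hd)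
  obtain ⟨T, hT⟩ := eventually_atTop.mp ((hlim.eventually h1).and ((hlim'.eventually h1).and
    (((hsum x hlim).eventually hball).and (((hsum x' hlim').eventually hball).and
      ((hlim.sub hlim').eventually (show ∀ᶠ z in 𝓝 (x₀ - x₀), |z| < 1 by
        rw [sub_self]
        filter_upwards [Metric.ball_mem_nhds (0 : ℝ) one_pos] with z hz
        simpa using hz))))))
  have hstep : ∀ t ≥ T, |x t - x' t| ≤ K * |x (t + 1) - x' (t + 1)| := by
    intro t ht
    obtain ⟨h2, h3, h4, h5, -⟩ := hT t ht
    rw [h2 _ (hx t), h3 _ (hx' t)]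
    simpa using hL _ _ h4 h5
  -- The gap at date `t + n` is at most 1, and each backward step multiplies it by at most `K`.
  have hpow : ∀ n, ∀ t ≥ T, |x t - x' t| ≤ K ^ n := by
    intro n
    induction n with
    | zero => intro t ht; simpa using (hT t ht).2.2.2.2.le
    | succ n ih =>
      intro t ht
      calc _ ≤ K * |x (t + 1) - x' (t + 1)| := hstep t ht
        _ ≤ K * K ^ n := mul_le_mul_of_nonneg_left (ih (t + 1) (by omega)) hK0.le
        _ = _ := by ring
  refine ⟨T, fun t ht => ?_⟩
  have := ge_of_tendsto' (tendsto_pow_atTop_nhds_zero_of_lt_one hK0.le hK2) (fun n => hpow n t ht)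
  exact sub_eq_zero.mp (abs_nonpos_iff.mp this)

/-! ### CRRA utility and its tangents -/

/-- Real-valued CRRA period utility. -/
def crraReal (γ c : ℝ) : ℝ :=
  if γ = 1 then Real.log c else c ^ (1 - γ) / (1 - γ)

lemma crra_eq_crraReal {γ c : ℝ} (h : ¬(c = 0 ∧ 1 ≤ γ)) : crra γ c = (crraReal γ c : ℝ) := by
  unfold crra crraReal
  rw [if_neg h]
  split_ifs <;> rfl

lemma crra_of_pos {γ c : ℝ} (hc : 0 < c) : crra γ c = (crraReal γ c : ℝ) :=
  crra_eq_crraReal fun h => hc.ne' h.1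

lemma hasDerivAt_crraReal (γ : ℝ) {c : ℝ} (hc : 0 < c) :
    HasDerivAt (crraReal γ) (c ^ (-γ)) c := by
  by_cases h : γ = 1
  · have : crraReal γ = Real.log := by funext x; simp [crraReal, h]
    rw [this, h, Real.rpow_neg_one]
    exact Real.hasDerivAt_log hc.ne'
  · have : crraReal γ = fun x => x ^ (1 - γ) / (1 - γ) := by funext x; simp [crraReal, h]
    have h1 : 1 - γ ≠ 0 := sub_ne_zero.mpr (Ne.symm h)
    rw [this]
    have h2 := (Real.hasDerivAt_rpow_const (p := 1 - γ) (Or.inl hc.ne')).div_const (1 - γ)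
    rwa [mul_div_cancel_left₀ _ h1, show 1 - γ - 1 = -γ by ring] at h2

/-- Bernoulli's inequality divided by p. For p < 0 the inequality for r^p reverses, and so does the
division; r = 0 is allowed only when p > 0. -/
lemma rpow_div_sub_le {p r : ℝ} (hp : p ≠ 0) (hp1 : p ≤ 1) (hr : 0 ≤ r) (h : 0 < r ∨ 0 < p) :
    r ^ p / p ≤ 1 / p + (r - 1) := by
  rcases lt_or_gt_of_ne hp with hp0 | hp0
  · have hr0 : 0 < r := h.resolve_right hp0.not_gt
    have h1 : 1 + p * (r - 1) ≤ r ^ p := by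
      rw [Real.rpow_def_of_pos hr0]
      have := Real.add_one_le_exp (Real.log r * p)
      have := Real.log_le_sub_one_of_pos hr0
      nlinarith
    have : r ^ p / p ≤ (1 + p * (r - 1)) / p := div_le_div_of_nonpos_of_le hp0.le h1
    rwa [add_div, mul_div_cancel_left₀ _ hp] at this
  · have h1 := rpow_one_add_le_one_add_mul_self (s := r - 1) (by linarith) hp0.le hp1
    rw [add_sub_cancel] at h1
    have : r ^ p / p ≤ (1 + p * (r - 1)) / p := by gcongr
    rwa [add_div, mul_div_cancel_left₀ _ hp] at this

/-- CRRA utility lies below its tangents. -/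
lemma crraReal_le_tangent {γ c c' : ℝ} (hγ : 0 < γ) (hc : 0 < c) (hc' : 0 ≤ c')
    (h : 0 < c' ∨ γ < 1) : crraReal γ c' ≤ crraReal γ c + c ^ (-γ) * (c' - c) := by
  unfold crraReal
  by_cases h1 : γ = 1
  · have hc0 : 0 < c' := h.resolve_right (by rw [h1]; exact lt_irrefl _)
    rw [if_pos h1, if_pos h1, h1, Real.rpow_neg_one]
    have := Real.log_le_sub_one_of_pos (div_pos hc0 hc)
    rw [Real.log_div hc0.ne' hc.ne'] at this
    have h2 : c⁻¹ * (c' - c) = c' / c - 1 := by field_simp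
    rw [h2]; linarith
  · rw [if_neg h1, if_neg h1]
    have hp : 1 - γ ≠ 0 := sub_ne_zero.mpr (Ne.symm h1)
    have h2 := rpow_div_sub_le (p := 1 - γ) (r := c' / c) hp (by linarith) (by positivity)
      (h.imp (fun h => div_pos h hc) (fun h => by linarith))
    have h3 : 0 < c ^ (1 - γ) := Real.rpow_pos_of_pos hc _
    rw [Real.div_rpow hc' hc.le] at h2
    have h4 : c ^ (-γ) = c ^ (1 - γ) / c := by
      rw [← Real.rpow_sub_one hc.ne']; ring_nf
    rw [h4]
    have h5 := mul_le_mul_of_nonneg_left h2 h3.le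
    calc c' ^ (1 - γ) / (1 - γ)
        = c ^ (1 - γ) * (c' ^ (1 - γ) / c ^ (1 - γ) / (1 - γ)) := by field_simp
      _ ≤ _ := h5
      _ = _ := by field_simp

lemma crra_le_tangent {γ c c' : ℝ} (hγ : 0 < γ) (hc : 0 < c) (hc' : 0 ≤ c') :
    crra γ c' ≤ ((crraReal γ c + c ^ (-γ) * (c' - c) : ℝ) : EReal) := by
  by_cases h : c' = 0 ∧ 1 ≤ γ
  · simp [crra, h]
  · rw [crra_eq_crraReal h, EReal.coe_le_coe_iff]
    refine crraReal_le_tangent hγ hc hc' ?_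
    rcases hc'.eq_or_lt with h0 | h0
    · exact Or.inr (lt_of_not_ge fun h1 => h ⟨h0.symm, h1⟩)
    · exact Or.inl h0

/-! ### First-order conditions of equilibrium, and the bubble criterion -/

section Economy

variable {β γ G a b D : ℝ}

lemma crraEconomy_U_of_pos {t : ℕ} {y z : ℝ} (hy : 0 < y) (hz : 0 < z) :
    (crraEconomy β γ G a b D).U t y z = ((crraReal γ y + β * crraReal γ z : ℝ) : EReal) := by
  simp only [crraEconomy, crra_of_pos hy, crra_of_pos hz]
  push_cast; rfl

/-- The Euler equation suffices for optimality at interior consumption. -/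
lemma crraEconomy_optimal_of_euler {P : ℕ → ℝ} {t : ℕ} {x₀ y₀ z₀ x y z : ℝ}
    (hβ : 0 < β) (hγ : 0 < γ) (hy₀ : 0 < y₀) (hz₀ : 0 < z₀)
    (h₀ : (crraEconomy β γ G a b D).InBudget P t x₀ y₀ z₀)
    (heuler : y₀ ^ (-γ) * P t = β * z₀ ^ (-γ) * (P (t + 1) + D))
    (h : (crraEconomy β γ G a b D).InBudget P t x y z) :
    (crraEconomy β γ G a b D).U t y z ≤ (crraEconomy β γ G a b D).U t y₀ z₀ := by
  have h1 := crra_le_tangent hγ hy₀ h.young_nonneg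
  have h2 := crra_le_tangent hγ hz₀ h.old_nonneg
  have h3 : (β : EReal) * crra γ z ≤
      (β : EReal) * ((crraReal γ z₀ + z₀ ^ (-γ) * (z - z₀) : ℝ) : EReal) :=
    mul_le_mul_of_nonneg_left h2 (by exact_mod_cast hβ.le)
  rw [crraEconomy_U_of_pos hy₀ hz₀]
  refine (add_le_add h1 h3).trans ?_
  rw [← EReal.coe_mul, ← EReal.coe_add, EReal.coe_le_coe_iff]
  have e1 : y - y₀ = -P t * (x - x₀) := by
    have := h.young; have := h₀.young; simp only [crraEconomy] at *; linarith
  have e2 : z - z₀ = (P (t + 1) + D) * (x - x₀) := by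
    have := h.old; have := h₀.old; simp only [crraEconomy] at *; linarith
  rw [e1, e2]
  refine le_of_eq ?_
  -- Along the budget line the two tangent terms are proportional to x - x₀, and the Euler equation
  -- makes them cancel.
  linear_combination -(x - x₀) * heuler

variable {A : PriceAllocation}

lemma equilibrium_young (hA : (crraEconomy β γ G a b D).IsEquilibrium A) (t : ℕ) :
    A.y t = a * G ^ t - A.P t := by
  have h1 := (hA.feasible t).young
  rw [hA.asset_clearing] at h1
  simp only [crraEconomy] at h1
  linarith

lemma equilibrium_old (hA : (crraEconomy β γ G a b D).IsEquilibrium A) (t : ℕ) :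
    A.z t = b * G ^ t + A.P t + D := by
  cases t with
  | zero => simpa [crraEconomy] using hA.initial_old
  | succ t =>
    have h1 := (hA.feasible t).old
    rw [hA.asset_clearing] at h1
    simp only [crraEconomy] at h1
    linarith

/-- An equilibrium is determined by its prices. -/
lemma equilibrium_ext {A' : PriceAllocation} (hA : (crraEconomy β γ G a b D).IsEquilibrium A)
    (hA' : (crraEconomy β γ G a b D).IsEquilibrium A') (hP : A.P = A'.P) : A = A' := by
  have hx : A.x = A'.x := funext fun t => by rw [hA.asset_clearing, hA'.asset_clearing]
  have hy : A.y = A'.y := funext fun t => by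
    rw [equilibrium_young hA, equilibrium_young hA', hP]
  have hz : A.z = A'.z := funext fun t => by
    rw [equilibrium_old hA, equilibrium_old hA', hP]
  cases A; cases A'; simp only at *; subst hP hx hy hz; rfl

lemma equilibrium_old_pos (hG : 1 < G) (hb : 0 ≤ b) (hD : 0 < D)
    (hA : (crraEconomy β γ G a b D).IsEquilibrium A) (t : ℕ) : 0 < A.z t := by
  rw [equilibrium_old hA]
  have := hA.price_nonneg t
  have : 0 ≤ b * G ^ t := by positivity
  linarith

/-- A zero price would make unlimited asset purchases profitable. -/
lemma equilibrium_price_pos (hβ : 0 < β) (hG : 1 < G) (ha : 0 < a) (hb : 0 ≤ b)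
    (hD : 0 < D) (hA : (crraEconomy β γ G a b D).IsEquilibrium A) (t : ℕ) : 0 < A.P t := by
  refine (hA.price_nonneg t).lt_of_ne fun h0 => ?_
  have hy : 0 < A.y t := by rw [equilibrium_young hA, ← h0]; simp; positivity
  have hz := equilibrium_old_pos hG hb hD hA (t + 1)
  have hR : 0 < A.P (t + 1) + D := by have := hA.price_nonneg (t + 1); linarith
  have hopt := hA.optimal t 2 (A.y t) (A.z (t + 1) + (A.P (t + 1) + D))
    ⟨hy.le, by linarith, by rw [equilibrium_young hA, ← h0]; simp [crraEconomy],
      by rw [equilibrium_old hA]; simp only [crraEconomy]; ring⟩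
  rw [crraEconomy_U_of_pos hy (by linarith), crraEconomy_U_of_pos hy hz,
    EReal.coe_le_coe_iff] at hopt
  have hlt : crraReal γ (A.z (t + 1)) < crraReal γ (A.z (t + 1) + (A.P (t + 1) + D)) := by
    refine strictMonoOn_of_deriv_pos (convex_Ioi 0) (fun c hc =>
      (hasDerivAt_crraReal γ hc).continuousAt.continuousWithinAt) (fun c hc => ?_)
      (Set.mem_Ioi.mpr hz) (Set.mem_Ioi.mpr (by linarith)) (by linarith)
    rw [interior_Ioi] at hc
    rw [(hasDerivAt_crraReal γ hc).deriv]
    exact Real.rpow_pos_of_pos hc _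
  nlinarith

/-- Young consumption is positive, because marginal utility is infinite at zero. -/
lemma equilibrium_young_pos (hβ : 0 < β) (hγ : 0 < γ) (hG : 1 < G) (ha : 0 < a) (hb : 0 ≤ b)
    (hD : 0 < D) (hA : (crraEconomy β γ G a b D).IsEquilibrium A) (t : ℕ) : 0 < A.y t := by
  refine ((hA.feasible t).young_nonneg).lt_of_ne fun h0 => ?_
  have hP := equilibrium_price_pos hβ hG ha hb hD hA t
  have hz := equilibrium_old_pos hG hb hD hA (t + 1)
  set R := A.P (t + 1) + D with hRdef
  have hR : 0 < R := by have := hA.price_nonneg (t + 1); linarith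
  have hzR : R ≤ A.z (t + 1) := by
    rw [equilibrium_old hA]
    have : 0 ≤ b * G ^ (t + 1) := by positivity
    linarith
  -- Deviation: sell ε of the asset when young consumption is zero. The bound ε ≤ 1/2 keeps old
  -- consumption at least R/2.
  have hopt : ∀ ε, 0 < ε → ε ≤ 1 / 2 →
      (crraEconomy β γ G a b D).U t (A.P t * ε) (A.z (t + 1) - R * ε) ≤
        (crraEconomy β γ G a b D).U t 0 (A.z (t + 1)) := by
    intro ε h1 h2
    have h3 := hA.optimal t (1 - ε) (A.P t * ε) (A.z (t + 1) - R * ε)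
      ⟨by positivity, by nlinarith, by
        have := equilibrium_young hA t
        simp only [crraEconomy]; linarith, by
        rw [equilibrium_old hA]; simp only [crraEconomy, hRdef]; ring⟩
    rwa [← h0] at h3
  rcases le_or_gt 1 γ with h1 | h1
  · have h2 := hopt (1 / 2) (by norm_num) le_rfl
    rw [crraEconomy_U_of_pos (by positivity) (by nlinarith)] at h2
    have h3 : (crraEconomy β γ G a b D).U t 0 (A.z (t + 1)) = ⊥ := by
      simp [crraEconomy, crra, h1]
    rw [h3] at h2
    exact absurd (le_bot_iff.mp h2) (EReal.coe_ne_bot _)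
  -- For γ < 1 the gain is of order ε^(1-γ) and the loss at most Mε; dividing by ε^(1-γ) and letting
  -- ε → 0 gives a contradiction.
  · set M := β * R * (R / 2) ^ (-γ) with hM
    have hbound : ∀ ε, 0 < ε → ε ≤ 1 / 2 → A.P t ^ (1 - γ) / (1 - γ) ≤ M * ε ^ γ := by
      intro ε he he2
      have h2 := hopt ε he he2
      have hzε : R / 2 ≤ A.z (t + 1) - R * ε := by nlinarith
      have hzε0 : 0 < A.z (t + 1) - R * ε := by linarith [half_pos hR]
      rw [crraEconomy_U_of_pos (by positivity) hzε0] at h2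
      have h3 : (crraEconomy β γ G a b D).U t 0 (A.z (t + 1)) =
          ((β * crraReal γ (A.z (t + 1)) : ℝ) : EReal) := by
        have h4 : crraReal γ 0 = 0 := by
          simp [crraReal, h1.ne, Real.zero_rpow (sub_pos.mpr h1).ne']
        simp only [crraEconomy, crra_of_pos hz]
        rw [crra_eq_crraReal (fun h => h1.not_ge h.2), h4]
        simp
      rw [h3, EReal.coe_le_coe_iff] at h2
      have h4 := crraReal_le_tangent hγ hzε0 hz.le (Or.inl hz)
      have h5 : (A.z (t + 1) - R * ε) ^ (-γ) ≤ (R / 2) ^ (-γ) :=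
        Real.rpow_le_rpow_of_nonpos (half_pos hR) hzε (by linarith)
      have h6 : crraReal γ (A.P t * ε) ≤ M * ε := by
        have h7 : (A.z (t + 1) - R * ε) ^ (-γ) * (R * ε) ≤ (R / 2) ^ (-γ) * (R * ε) := by gcongr
        rw [show A.z (t + 1) - (A.z (t + 1) - R * ε) = R * ε by ring] at h4
        have h8 := mul_le_mul_of_nonneg_left (h4.trans (add_le_add_right h7 _)) hβ.le
        rw [hM]; linarith
      have h7 : crraReal γ (A.P t * ε) = A.P t ^ (1 - γ) / (1 - γ) * ε ^ (1 - γ) := by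
        rw [crraReal, if_neg h1.ne, Real.mul_rpow hP.le he.le]; ring
      rw [h7] at h6
      have h9 : 0 < ε ^ (1 - γ) := Real.rpow_pos_of_pos he _
      have h8 : M * ε = M * ε ^ γ * ε ^ (1 - γ) := by
        rw [mul_assoc M, ← Real.rpow_add he]; simp
      rw [h8] at h6
      exact le_of_mul_le_mul_right h6 h9
    have hlim : Tendsto (fun ε : ℝ => M * ε ^ γ) (𝓝[>] 0) (𝓝 0) := by
      have := (Real.continuousAt_rpow_const 0 γ (Or.inr hγ.le)).tendsto.const_mul M
      rw [Real.zero_rpow hγ.ne', mul_zero] at this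
      exact this.mono_left nhdsWithin_le_nhds
    have h2 : A.P t ^ (1 - γ) / (1 - γ) ≤ 0 := by
      refine ge_of_tendsto hlim ?_
      filter_upwards [Ioc_mem_nhdsGT (show (0 : ℝ) < 1 / 2 by norm_num)] with ε hε
      exact hbound ε hε.1 hε.2
    have h3 : 0 < A.P t ^ (1 - γ) / (1 - γ) :=
      div_pos (Real.rpow_pos_of_pos hP _) (by linarith)
    linarith

/-- The Euler equation holds in equilibrium. -/
lemma equilibrium_euler (hβ : 0 < β) (hγ : 0 < γ) (hG : 1 < G) (ha : 0 < a) (hb : 0 ≤ b)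
    (hD : 0 < D) (hA : (crraEconomy β γ G a b D).IsEquilibrium A) (t : ℕ) :
    A.y t ^ (-γ) * A.P t = β * A.z (t + 1) ^ (-γ) * (A.P (t + 1) + D) := by
  have hy := equilibrium_young_pos hβ hγ hG ha hb hD hA t
  have hz := equilibrium_old_pos hG hb hD hA (t + 1)
  -- Consumption after buying `s` more units; s = 0 is an interior maximum.
  let Y : ℝ → ℝ := fun s => A.y t - A.P t * s
  let Z : ℝ → ℝ := fun s => A.z (t + 1) + (A.P (t + 1) + D) * s
  have hY : HasDerivAt Y (-(A.P t * 1)) 0 := ((hasDerivAt_id 0).const_mul _).const_sub _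
  have hZ : HasDerivAt Z ((A.P (t + 1) + D) * 1) 0 := ((hasDerivAt_id 0).const_mul _).const_add _
  have hY0 : Y 0 = A.y t := by simp [Y]
  have hZ0 : Z 0 = A.z (t + 1) := by simp [Z]
  have hmax : IsLocalMax (fun s => crraReal γ (Y s) + β * crraReal γ (Z s)) 0 := by
    have h1 : ∀ᶠ s in 𝓝 (0 : ℝ), 0 < Y s :=
      hY.continuousAt.eventually (lt_mem_nhds (by rwa [hY0]))
    have h2 : ∀ᶠ s in 𝓝 (0 : ℝ), 0 < Z s :=
      hZ.continuousAt.eventually (lt_mem_nhds (by rwa [hZ0]))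
    filter_upwards [h1, h2] with s h1 h2
    have h3 := hA.optimal t (1 + s) (Y s) (Z s) ⟨h1.le, h2.le, by
        simp only [crraEconomy, Y]; rw [equilibrium_young hA]; ring, by
        simp only [crraEconomy, Z]; rw [equilibrium_old hA]; ring⟩
    rw [crraEconomy_U_of_pos h1 h2, crraEconomy_U_of_pos hy hz, EReal.coe_le_coe_iff] at h3
    rwa [hY0, hZ0]
  have hd1 : HasDerivAt (fun s => crraReal γ (Y s)) _ 0 :=
    HasDerivAt.comp (0 : ℝ) (hasDerivAt_crraReal γ (by rwa [hY0])) hY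
  have hd2 : HasDerivAt (fun s => crraReal γ (Z s)) _ 0 :=
    HasDerivAt.comp (0 : ℝ) (hasDerivAt_crraReal γ (by rwa [hZ0])) hZ
  have h0 := hmax.hasDerivAt_eq_zero (hd1.add (hd2.const_mul β))
  rw [hY0, hZ0] at h0
  linarith

/-- If dividends are small relative to prices, in the sense that `∑ D / P t < ∞`, the asset is
priced above its fundamental value. -/
lemma isBubbly_of_summable {P : ℕ → ℝ} (hD : 0 < D) (hP : ∀ t, 0 < P t)
    (hs : Summable fun t => D / P t) : (crraEconomy β γ G a b D).IsBubbly P := by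
  let q : ℕ → ℝ := fun t => ∏ i ∈ Finset.range t, (P i / (P (i + 1) + D))
  have hR : ∀ t, 0 < P t + D := fun t => add_pos (hP t) hD
  have hq : ∀ t, 0 < q t := fun t => Finset.prod_pos fun i _ => div_pos (hP i) (hR _)
  have hna : ∀ t, q t * P t = q (t + 1) * (P (t + 1) + D) := fun t => by
    have := (hR (t + 1)).ne'
    simp only [q, Finset.prod_range_succ]
    field_simp
  set S := ∑' t, D / P (t + 1) with hS
  have hs' : Summable fun t => D / P (t + 1) := (summable_nat_add_iff 1).mpr hs
  -- From 1/(1+u) ≥ e^(-u) with u = D/P, the term q_n P_n stays above P_0 e^(-S) > 0.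
  have hlow : ∀ n, P 0 * Real.exp (-∑ i ∈ Finset.range n, D / P (i + 1)) ≤ q n * P n := by
    intro n
    induction n with
    | zero => simp [q]
    | succ n ih =>
      have h1 : P (n + 1) / (P (n + 1) + D) * (q n * P n) = q (n + 1) * P (n + 1) := by
        rw [hna n]
        have := (hR (n + 1)).ne'
        field_simp
      have h2 : Real.exp (-(D / P (n + 1))) ≤ P (n + 1) / (P (n + 1) + D) := by
        rw [Real.exp_neg, inv_le_comm₀ (Real.exp_pos _) (div_pos (hP _) (hR _)), inv_div]
        have := Real.add_one_le_exp (D / P (n + 1))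
        have h3 : (P (n + 1) + D) / P (n + 1) = D / P (n + 1) + 1 := by
          have := (hP (n + 1)).ne'
          field_simp; ring
        rwa [h3]
      rw [← h1, Finset.sum_range_succ, neg_add, Real.exp_add, ← mul_assoc, mul_comm]
      refine mul_le_mul h2 ih (by have := hP 0; positivity) (div_pos (hP _) (hR _)).le
  -- No-arbitrage telescopes: the limit of q_n P_n is the bubble component of P_0.
  have hsum : ∀ n, ∑ i ∈ Finset.range n, q (i + 1) * D = P 0 - q n * P n := by
    intro n
    induction n with
    | zero => simp [q]
    | succ n ih => rw [Finset.sum_range_succ, ih, hna n]; ring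
  have hm : 0 < P 0 * Real.exp (-S) := mul_pos (hP 0) (Real.exp_pos _)
  refine ⟨q, ⟨by simp [q], hq, hna⟩, ?_⟩
  refine lt_of_le_of_lt (b := ENNReal.ofReal (P 0 - P 0 * Real.exp (-S))) ?_
    ((ENNReal.ofReal_lt_ofReal_iff (hP 0)).mpr (by linarith))
  unfold OLGEconomy.fundamentalValue
  rw [ENNReal.tsum_eq_iSup_nat]
  refine iSup_le fun n => ?_
  change ∑ i ∈ Finset.range n, ENNReal.ofReal (q (i + 1) * D) ≤ _
  rw [← ENNReal.ofReal_sum_of_nonneg fun i _ => mul_nonneg (hq _).le hD.le]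
  refine ENNReal.ofReal_le_ofReal ?_
  have h1 : ∑ i ∈ Finset.range n, D / P (i + 1) ≤ S :=
    hs'.sum_le_tsum _ fun i _ => (div_pos hD (hP _)).le
  have h2 : P 0 * Real.exp (-S) ≤ P 0 * Real.exp (-∑ i ∈ Finset.range n, D / P (i + 1)) := by
    have := (hP 0).le
    gcongr
  calc _ = P 0 - q n * P n := hsum n
    _ ≤ _ := by linarith [hlow n]

end Economy

/-! ### Detrended paths -/

/-- The Euler equation in detrended logarithmic form. -/
lemma euler_iff_log {β γ G w x e Y : ℝ} (hβ : 0 < β) (hG : 0 < G) (hw : 0 ≤ w) (hY : 0 < Y)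
    (hx0 : 0 < x) (hx1 : x < 1) (he : 0 < e) :
    (Y * (1 - x)) ^ (-γ) * (Y * x) = β * (Y * G * (w + e)) ^ (-γ) * (Y * G * e) ↔
      Real.log x - γ * Real.log (1 - x) =
        Real.log β + (1 - γ) * Real.log G + (Real.log e - γ * Real.log (w + e)) := by
  have h1 : 0 < 1 - x := by linarith
  have h2 : 0 < w + e := by linarith
  rw [← Real.log_injOn_pos.eq_iff (by simp only [Set.mem_Ioi]; positivity)
      (by simp only [Set.mem_Ioi]; positivity),
    Real.log_mul (Real.rpow_pos_of_pos (by positivity) _).ne' (by positivity),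
    Real.log_mul (mul_pos hβ (Real.rpow_pos_of_pos (by positivity) _)).ne' (by positivity),
    Real.log_mul hβ.ne' (Real.rpow_pos_of_pos (by positivity) _).ne', Real.log_rpow (by positivity),
    Real.log_rpow (by positivity), Real.log_mul hY.ne' h1.ne', Real.log_mul hY.ne' hx0.ne',
    Real.log_mul (by positivity) h2.ne', Real.log_mul (by positivity) he.ne',
    Real.log_mul hY.ne' hG.ne']
  constructor <;> intro h <;> linarith

/-- Exponentiated, the equation reads x = e^c (1-x)^γ, whose two sides cross between 0 and 1. This
makes every backward step solvable. -/
lemma exists_log_sub_mul_log_eq {γ : ℝ} (hγ : 0 < γ) (c : ℝ) :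
    ∃ x : ℝ, 0 < x ∧ x < 1 ∧ Real.log x - γ * Real.log (1 - x) = c := by
  have hcont : ContinuousOn (fun x : ℝ => x - Real.exp c * (1 - x) ^ γ) (Set.Icc 0 1) := by
    refine Continuous.continuousOn ?_
    exact continuous_id.sub (continuous_const.mul
      ((continuous_const.sub continuous_id).rpow_const fun _ => Or.inr hγ.le))
  have hc := Real.exp_pos c
  obtain ⟨x, ⟨hx0, hx1⟩, hx⟩ := intermediate_value_Ioo zero_le_one hcont
    (show (0 : ℝ) ∈ _ by simp [Real.zero_rpow hγ.ne', hc])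
  refine ⟨x, hx0, hx1, ?_⟩
  have h1 : 0 < 1 - x := by linarith
  have h2 : x = Real.exp c * (1 - x) ^ γ := sub_eq_zero.mp hx
  have h3 : Real.log x = c + γ * Real.log (1 - x) := by
    conv_lhs => rw [h2]
    rw [Real.log_mul hc.ne' (Real.rpow_pos_of_pos h1 _).ne', Real.log_exp, Real.log_rpow h1]
  linarith

lemma log_sub_mul_log_injective {γ x y : ℝ} (hγ : 0 < γ) (hx0 : 0 < x) (hx1 : x < 1)
    (hy0 : 0 < y) (hy1 : y < 1)
    (h : Real.log x - γ * Real.log (1 - x) = Real.log y - γ * Real.log (1 - y)) : x = y := by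
  have key : ∀ x y : ℝ, 0 < x → y < 1 → x < y →
      Real.log x - γ * Real.log (1 - x) < Real.log y - γ * Real.log (1 - y) := by
    intro x y hx0 hy1 hxy
    have h1 := Real.log_lt_log hx0 hxy
    have h2 := Real.log_lt_log (show 0 < 1 - y by linarith) (show 1 - y < 1 - x by linarith)
    nlinarith
  rcases lt_trichotomy x y with hlt | heq | hlt
  · exact absurd h (key x y hx0 hy1 hlt).ne
  · exact heq
  · exact absurd h (key y x hy0 hx1 hlt).ne'

/-- A perfect foresight path of detrended asset prices: a solution of the Euler equation in
detrended logarithmic form. -/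
structure IsDetrendedPath (β γ G w : ℝ) (d : ℕ → ℝ) (T : ℕ) (x : ℕ → ℝ) : Prop where
  pos : ∀ t ≥ T, 0 < x t
  lt_one : ∀ t ≥ T, x t < 1
  euler : ∀ t ≥ T, Real.log (x t) - γ * Real.log (1 - x t) =
    Real.log β + (1 - γ) * Real.log G +
      (Real.log (x (t + 1) + d (t + 1)) - γ * Real.log (w + (x (t + 1) + d (t + 1))))

/-- A path from date `T` on extends backwards to date `0`. -/
lemma IsDetrendedPath.exists_extension {β γ G w ξ : ℝ} {d : ℕ → ℝ} (hγ : 0 < γ) :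
    ∀ (T : ℕ) (x : ℕ → ℝ), IsDetrendedPath β γ G w d T x → Tendsto x atTop (𝓝 ξ) →
      ∃ x' : ℕ → ℝ, IsDetrendedPath β γ G w d 0 x' ∧ Tendsto x' atTop (𝓝 ξ) := by
  intro T
  induction T with
  | zero => exact fun x hx hlim => ⟨x, hx, hlim⟩
  | succ T ih =>
    intro x hx hlim
    obtain ⟨v, hv0, hv1, hv⟩ := exists_log_sub_mul_log_eq hγ
      (Real.log β + (1 - γ) * Real.log G +
        (Real.log (x (T + 1) + d (T + 1)) - γ * Real.log (w + (x (T + 1) + d (T + 1)))))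
    refine ih (Function.update x T v) ⟨?_, ?_, ?_⟩ (hlim.congr' ?_)
    · intro t ht
      rcases eq_or_ne t T with rfl | hne
      · simpa using hv0
      · simpa [hne] using hx.pos t (by omega)
    · intro t ht
      rcases eq_or_ne t T with rfl | hne
      · simpa using hv1
      · simpa [hne] using hx.lt_one t (by omega)
    · intro t ht
      rw [Function.update_of_ne (show t + 1 ≠ T by omega)]
      rcases eq_or_ne t T with rfl | hne
      · simpa using hv
      · rw [Function.update_of_ne hne]
        exact hx.euler t (by omega)
    · filter_upwards [eventually_gt_atTop T] with t ht
      rw [Function.update_of_ne ht.ne']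

/-- Two paths that coincide eventually coincide. -/
lemma IsDetrendedPath.eq_of_eventually_eq {β γ G w : ℝ} {d x x' : ℕ → ℝ} (hγ : 0 < γ)
    (hx : IsDetrendedPath β γ G w d 0 x) (hx' : IsDetrendedPath β γ G w d 0 x') :
    ∀ T, (∀ t ≥ T, x t = x' t) → x = x' := by
  intro T
  induction T with
  | zero => exact fun h => funext fun t => h t (Nat.zero_le t)
  | succ T ih =>
    intro h
    refine ih fun t ht => ?_
    rcases eq_or_ne t T with rfl | hne
    · refine log_sub_mul_log_injective hγ (hx.pos t (Nat.zero_le t)) (hx.lt_one t (Nat.zero_le t))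
        (hx'.pos t (Nat.zero_le t)) (hx'.lt_one t (Nat.zero_le t)) ?_
      rw [hx.euler t (Nat.zero_le t), hx'.euler t (Nat.zero_le t), h (t + 1) le_rfl]
    · exact h t (by omega)

/-! ### The steady state and the slopes there -/

section Steady

variable {β γ G a b D w κ ξ : ℝ}

lemma hasStrictDerivAt_log_young (hξ0 : 0 < ξ) (hξ1 : ξ < 1) :
    HasStrictDerivAt (fun x => Real.log x - γ * Real.log (1 - x)) (ξ⁻¹ + γ / (1 - ξ)) ξ := by
  have h1 : HasStrictDerivAt (fun x : ℝ => 1 - x) (-1) ξ := (hasStrictDerivAt_id ξ).const_sub 1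
  have h2 := (Real.hasStrictDerivAt_log hξ0.ne').sub
    ((h1.log (sub_pos.mpr hξ1).ne').const_mul γ)
  have h3 : ξ⁻¹ + γ / (1 - ξ) = ξ⁻¹ - γ * (-1 / (1 - ξ)) := by ring
  rw [h3]
  exact h2

lemma hasStrictDerivAt_log_old (c : ℝ) (hξ0 : 0 < ξ) (hw : 0 ≤ w) :
    HasStrictDerivAt (fun e => c + (Real.log e - γ * Real.log (w + e)))
      (ξ⁻¹ - γ / (w + ξ)) ξ := by
  have h1 : HasStrictDerivAt (fun x : ℝ => w + x) 1 ξ := (hasStrictDerivAt_id ξ).const_add w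
  have h2 := ((Real.hasStrictDerivAt_log hξ0.ne').sub
    ((h1.log (add_pos_of_nonneg_of_pos hw hξ0).ne').const_mul γ)).const_add c
  have h3 : ξ⁻¹ - γ / (w + ξ) = ξ⁻¹ - γ * (1 / (w + ξ)) := by ring
  rw [h3]
  exact h2

/-- In the absence of dividends the steady state solves the detrended Euler equation. -/
lemma steady_euler (hβ : 0 < β) (hγ : 0 < γ) (hG : 0 < G)
    (hκ : κ = (β * G ^ (1 - γ)) ^ (1 / γ)) (hκ0 : 0 < κ) (hξ1 : ξ < 1)
    (hs : w + ξ = κ * (1 - ξ)) :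
    Real.log ξ - γ * Real.log (1 - ξ) =
      Real.log β + (1 - γ) * Real.log G + (Real.log ξ - γ * Real.log (w + ξ)) := by
  have h1 : γ * Real.log κ = Real.log β + (1 - γ) * Real.log G := by
    have h2 : 0 < G ^ (1 - γ) := Real.rpow_pos_of_pos hG _
    rw [hκ, Real.log_rpow (mul_pos hβ h2), Real.log_mul hβ.ne' h2.ne', Real.log_rpow hG]
    field_simp
  rw [hs, Real.log_mul hκ0.ne' (sub_pos.mpr hξ1).ne']
  linarith

/-- Since κ = β^(1/γ) G^(1/γ) / G and G^(1/γ) > 1, the endowment assumption gives w < β^(1/γ)/G < κ.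
This makes ξ positive. -/
lemma w_lt_kappa (hβ : 0 < β) (hγ : 0 < γ) (hG : 1 < G) (ha : 0 < a)
    (hyoung : β ^ (-(1 / γ)) * G * b < a) (hw : w = b / a)
    (hκ : κ = (β * G ^ (1 - γ)) ^ (1 / γ)) : w < κ := by
  have hG0 : 0 < G := by linarith
  have hB : 0 < β ^ (1 / γ) := Real.rpow_pos_of_pos hβ _
  have h1 : κ = β ^ (1 / γ) * G ^ (1 / γ) / G := by
    rw [hκ, Real.mul_rpow hβ.le (Real.rpow_pos_of_pos hG0 _).le, ← Real.rpow_mul hG0.le,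
      show (1 - γ) * (1 / γ) = 1 / γ - 1 by field_simp, Real.rpow_sub_one hG0.ne']
    ring
  have h2 : 1 < G ^ (1 / γ) := Real.one_lt_rpow hG (by positivity)
  rw [Real.rpow_neg hβ.le, mul_assoc, inv_mul_lt_iff₀ hB] at hyoung
  rw [hw, h1, div_lt_div_iff₀ ha hG0]
  nlinarith [mul_pos hB ha]

end Steady

/-! ### Correspondence between equilibria and detrended paths -/

section Paths

variable {β γ G a b D w ξ : ℝ}

/-- Equilibria have detrended prices that form a path. -/
lemma equilibrium_isDetrendedPath {A : PriceAllocation} (hβ : 0 < β) (hγ : 0 < γ) (hG : 1 < G)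
    (ha : 0 < a) (hb : 0 ≤ b) (hD : 0 < D) (hw : w = b / a)
    (hA : (crraEconomy β γ G a b D).IsEquilibrium A) :
    IsDetrendedPath β γ G w (fun t => D / (a * G ^ t)) 0 (fun t => A.P t / (a * G ^ t)) := by
  have hG0 : 0 < G := by linarith
  have hY : ∀ t : ℕ, 0 < a * G ^ t := fun t => by positivity
  have hP := equilibrium_price_pos hβ hG ha hb hD hA
  have hx0 : ∀ t, 0 < A.P t / (a * G ^ t) := fun t => div_pos (hP t) (hY t)
  have hx1 : ∀ t, A.P t / (a * G ^ t) < 1 := fun t => by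
    rw [div_lt_one (hY t)]
    have := equilibrium_young_pos hβ hγ hG ha hb hD hA t
    rw [equilibrium_young hA] at this
    linarith
  refine ⟨fun t _ => hx0 t, fun t _ => hx1 t, fun t _ => ?_⟩
  have hd : 0 < D / (a * G ^ (t + 1)) := div_pos hD (hY _)
  rw [← euler_iff_log hβ hG0 (by rw [hw]; positivity) (hY t) (hx0 t) (hx1 t)
    (add_pos (hx0 (t + 1)) hd)]
  have h1 := equilibrium_euler hβ hγ hG ha hb hD hA t
  rw [equilibrium_young hA, equilibrium_old hA] at h1
  have hGt : 0 < G ^ t := by positivity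
  convert h1 using 2
  · congr 1; field_simp
  · field_simp
  · congr 2; rw [hw, pow_succ]; field_simp; ring
  · rw [pow_succ]; field_simp

/-- A path of detrended prices with a positive limit is supported by an asymptotically bubbly
equilibrium. -/
lemma IsDetrendedPath.exists_asymptoticallyBubbly {x : ℕ → ℝ} (hβ : 0 < β) (hγ : 0 < γ)
    (hG : 1 < G) (ha : 0 < a) (hb : 0 ≤ b) (hD : 0 < D) (hw : w = b / a) (hξ : 0 < ξ)
    (hx : IsDetrendedPath β γ G w (fun t => D / (a * G ^ t)) 0 x)
    (hlim : Tendsto x atTop (𝓝 ξ)) :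
    ∃ A : PriceAllocation, (crraEconomy β γ G a b D).IsAsymptoticallyBubbly A ∧
      Tendsto (fun t : ℕ => A.P t / (a * G ^ t)) atTop (𝓝 ξ) := by
  have hG0 : 0 < G := by linarith
  have hY : ∀ t : ℕ, 0 < a * G ^ t := fun t => by positivity
  have hx0 : ∀ t, 0 < x t := fun t => hx.pos t (Nat.zero_le t)
  have hx1 : ∀ t, x t < 1 := fun t => hx.lt_one t (Nat.zero_le t)
  let P : ℕ → ℝ := fun t => a * G ^ t * x t
  have hP : ∀ t, 0 < P t := fun t => mul_pos (hY t) (hx0 t)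
  have hPx : (fun t : ℕ => P t / (a * G ^ t)) = x := funext fun t =>
    mul_div_cancel_left₀ _ (hY t).ne'
  have hy : ∀ t : ℕ, 0 < a * G ^ t - P t := fun t => by
    have := mul_lt_mul_of_pos_left (hx1 t) (hY t)
    simp only [P]; linarith
  have hz : ∀ t : ℕ, 0 < b * G ^ t + P t + D := fun t => by
    have := hP t
    have : 0 ≤ b * G ^ t := by positivity
    linarith
  have heuler : ∀ t : ℕ, (a * G ^ t - P t) ^ (-γ) * P t =
      β * (b * G ^ (t + 1) + P (t + 1) + D) ^ (-γ) * (P (t + 1) + D) := by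
    intro t
    have h1 := hx.euler t (Nat.zero_le t)
    rw [← euler_iff_log hβ hG0 (by rw [hw]; positivity) (hY t) (hx0 t) (hx1 t)
      (add_pos (hx0 (t + 1)) (div_pos hD (hY _)))] at h1
    have hGt : 0 < G ^ t := by positivity
    convert h1 using 2
    · congr 1; simp only [P]; ring
    · congr 2; simp only [P]; rw [hw, pow_succ]; field_simp; ring
    · simp only [P]; rw [pow_succ]; field_simp
  -- Eventually x_t > ξ/2, so D/P_t is dominated by a geometric series of ratio 1/G.
  have hsum : Summable fun t => D / P t := by
    have hgeo : Summable fun t : ℕ => 2 * D / (a * ξ) * (1 / G) ^ t :=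
      (summable_geometric_of_lt_one (by positivity) ((div_lt_one hG0).mpr hG)).mul_left _
    refine Summable.of_norm_bounded_eventually_nat hgeo ?_
    filter_upwards [hlim.eventually (lt_mem_nhds (half_lt_self hξ))] with t ht
    rw [Real.norm_of_nonneg (div_pos hD (hP t)).le]
    have hGt : 0 < G ^ t := by positivity
    have h2 : 2 * D / (a * ξ) * (1 / G) ^ t = D / (a * G ^ t * (ξ / 2)) := by
      rw [div_pow, one_pow]; field_simp
    rw [h2]
    have := hY t
    simp only [P]
    gcongr
  refine ⟨⟨P, fun _ => 1, fun t => a * G ^ t - P t, fun t => b * G ^ t + P t + D⟩,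
    ⟨?_, isBubbly_of_summable hD hP hsum, ?_⟩, by simpa only [hPx] using hlim⟩
  · have hbud : ∀ t, (crraEconomy β γ G a b D).InBudget P t 1 (a * G ^ t - P t)
        (b * G ^ (t + 1) + P (t + 1) + D) := fun t =>
      ⟨(hy t).le, (hz (t + 1)).le, by simp [crraEconomy], by simp only [crraEconomy]; ring⟩
    exact {
      price_nonneg := fun t => (hP t).le
      initial_old := by simp [crraEconomy]
      feasible := hbud
      optimal := fun t x y z h =>
        crraEconomy_optimal_of_euler hβ hγ (hy t) (hz (t + 1)) (hbud t) (heuler t) h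
      goods_clearing := fun t => by simp only [crraEconomy]; ring
      asset_clearing := fun _ => rfl }
  · have h1 : Tendsto (fun t => ((P t / (crraEconomy β γ G a b D).a t : ℝ) : EReal)) atTop
        (𝓝 (ξ : EReal)) := by
      refine (continuous_coe_real_ereal.tendsto ξ).comp ?_
      change Tendsto (fun t : ℕ => P t / (a * G ^ t)) atTop (𝓝 ξ)
      rwa [hPx]
    change 0 < liminf _ _
    rw [h1.liminf_eq]
    exact_mod_cast hξ

end Paths

end

/-! ### Existence and uniqueness -/

theorem mainTheorem11 (β γ G a b D : ℝ)
    (hβ : 0 < β) (hγ : 0 < γ) (hG : 1 < G) (ha : 0 < a) (hb : 0 ≤ b) (hD : 0 < D)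
    (hyoung : β ^ (-(1 / γ)) * G * b < a)
    (w κ ξ : ℝ) (hw : w = b / a) (hκ : κ = (β * G ^ (1 - γ)) ^ (1 / γ))
    (hξ : ξ = (κ - w) / (1 + κ))
    (hne : 1 / γ ≠ (κ - w) / (κ * (1 + w))) :
    (∃ A : PriceAllocation, (crraEconomy β γ G a b D).IsAsymptoticallyBubbly A ∧
        Tendsto (fun t : ℕ => A.P t / (a * G ^ t)) atTop (𝓝 ξ)) ∧
      (1 / γ > (1 / 2) * ((κ - w) / κ) * ((1 - κ) / (1 + w)) →
        ∃! A : PriceAllocation, (crraEconomy β γ G a b D).IsAsymptoticallyBubbly A ∧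
          Tendsto (fun t : ℕ => A.P t / (a * G ^ t)) atTop (𝓝 ξ)) := by
  have hG0 : 0 < G := by linarith
  have hw0 : 0 ≤ w := by rw [hw]; positivity
  have hwκ : w < κ := w_lt_kappa hβ hγ hG ha hyoung hw hκ
  have hκ0 : 0 < κ := by linarith
  have hκw : 0 < κ - w := by linarith
  have hξ0 : 0 < ξ := by rw [hξ]; positivity
  have h1ξ : 1 - ξ = (1 + w) / (1 + κ) := by rw [hξ]; field_simp; ring
  have hwξ : w + ξ = κ * (1 - ξ) := by rw [h1ξ, hξ]; field_simp; ring
  have hξ1 : ξ < 1 := by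
    have : 0 < 1 - ξ := by rw [h1ξ]; positivity
    linarith
  have hF := hasStrictDerivAt_log_young (γ := γ) hξ0 hξ1
  have hH := hasStrictDerivAt_log_old (γ := γ) (Real.log β + (1 - γ) * Real.log G) hξ0 hw0
  have h0 := steady_euler hβ hγ hG0 hκ hκ0 hξ1 hwξ
  have h1ξ0 : 0 < 1 - ξ := by linarith
  have hA : 0 < ξ⁻¹ + γ / (1 - ξ) := by positivity
  have hd : ∀ t : ℕ, |D / (a * G ^ t)| ≤ D / a * (1 / G) ^ t := fun t => by
    rw [abs_of_pos (by positivity), div_pow, one_pow, div_mul_div_comm, mul_one]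
  have hex : ∃ A : PriceAllocation, (crraEconomy β γ G a b D).IsAsymptoticallyBubbly A ∧
      Tendsto (fun t : ℕ => A.P t / (a * G ^ t)) atTop (𝓝 ξ) := by
    obtain ⟨T, x, hx, hlim⟩ := exists_tail hF hH h0 hA.ne' hG (div_pos hD ha) hd
    obtain ⟨T', hT'⟩ := eventually_atTop.mp (hlim.eventually (Ioo_mem_nhds hξ0 hξ1))
    have hpath : IsDetrendedPath β γ G w (fun t => D / (a * G ^ t)) (max T T') x :=
      ⟨fun t ht => (hT' t (le_of_max_le_right ht)).1, fun t ht => (hT' t (le_of_max_le_right ht)).2,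
        fun t ht => hx t (le_of_max_le_left ht)⟩
    obtain ⟨x', hx', hlim'⟩ := IsDetrendedPath.exists_extension hγ _ x hpath hlim
    exact hx'.exists_asymptoticallyBubbly hβ hγ hG ha hb hD hw hξ0 hlim'
  refine ⟨hex, fun hcond => ?_⟩
  obtain ⟨A, hAb, hlimA⟩ := hex
  refine ⟨A, ⟨hAb, hlimA⟩, fun A' ⟨hAb', hlimA'⟩ => ?_⟩
  -- The upper bound holds because B < 1/ξ < A. For the lower one, A + B is 2γ/ξ times the slack in
  -- the uniqueness condition.
  have hBA : |ξ⁻¹ - γ / (w + ξ)| < |ξ⁻¹ + γ / (1 - ξ)| := by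
    have hwξ0 : 0 < w + ξ := by linarith
    rw [abs_of_pos hA, abs_lt]
    constructor
    · have h1 : γ / (w + ξ) - γ / (1 - ξ) < 2 * ξ⁻¹ := by
        have h2 : 2 * ξ⁻¹ - (γ / (w + ξ) - γ / (1 - ξ)) = 2 * γ * ξ⁻¹ *
            (1 / γ - (1 / 2) * ((κ - w) / κ) * ((1 - κ) / (1 + w))) := by
          rw [hwξ, h1ξ, hξ]
          have : (0 : ℝ) < 1 + w := by linarith
          have : (0 : ℝ) < 1 + κ := by linarith
          field_simp
        have h3 : 0 < 2 * γ * ξ⁻¹ *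
            (1 / γ - (1 / 2) * ((κ - w) / κ) * ((1 - κ) / (1 + w))) :=
          mul_pos (by positivity) (sub_pos.mpr hcond)
        linarith
      linarith
    · have h1 : 0 < γ / (w + ξ) := by positivity
      have h2 : 0 < γ / (1 - ξ) := by positivity
      linarith
  have hpath := equilibrium_isDetrendedPath hβ hγ hG ha hb hD hw hAb.equilibrium
  have hpath' := equilibrium_isDetrendedPath hβ hγ hG ha hb hD hw hAb'.equilibrium
  have hd0 : Tendsto (fun t : ℕ => D / (a * G ^ t)) atTop (𝓝 0) := by
    refine squeeze_zero_norm hd ?_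
    simpa using (tendsto_pow_atTop_nhds_zero_of_lt_one (by positivity)
      ((div_lt_one hG0).mpr hG)).const_mul (D / a)
  obtain ⟨T, hT⟩ := eventually_eq_of_tendsto hF hH h0 hBA hd0
    (fun t => hpath.euler t (Nat.zero_le t)) (fun t => hpath'.euler t (Nat.zero_le t)) hlimA hlimA'
  have heq := hpath.eq_of_eventually_eq hγ hpath' T hT
  refine equilibrium_ext hAb'.equilibrium hAb.equilibrium (funext fun t => ?_)
  have h1 := congrFun heq t
  have h2 : a * G ^ t ≠ 0 := by positivity
  exact ((div_left_inj' h2).mp h1).symm
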